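/- Let $K$ be a field with algebraic closure $\overline K$, and let $\Delta(t,u)\in K[[t]][u]$. (1) If $\Delta$ has a square root in $K[[t,u]]$, then $\Delta$ can be factored in $\overline K[[t]][u]$ as $$\Delta(t,u)= c^2 t^{2p}\,(1+tS(t))\,\bigl(1+tuR_1(t,u)\bigr)\,\bigl(u^d+tR_2(t,u)\bigr)^2\prod_{i=1}^k\left(\Bigl(1-\frac u{\alpha_i}\Bigr)^{d_i}+tuQ_i(t,u)\right),$$ where $p,d,k$ are nonnegative integers, the $d_i$ are positive integers, $c\in K$, the $\alpha_i$ are pairwise distinct non-zero elements of $\overline K$, $S\in K[[t]]$, $R_1,R_2\in K[[t]][u]$ with $\deg_u R_2<d$, and $Q_i\in\overline K[[t]][u]$ with $\deg_u Q_i<d_i$ (here $\deg_u 0=-\infty$). (2) If $\Delta$ has a square root in $K[u][[t]]$, then $\Delta$ can be factored in $\overline K[[t]][u]$ as $$\Delta(t,u)= c^2 t^{2p}\,(1+tS(t))\,\bigl(1+tuR_1(t,u)\bigr)\,\bigl(u^d+tR_2(t,u)\bigr)^2\prod_{i=1}^k\left(\Bigl(1-\frac u{\alpha_i}\Bigr)^{d_i}+tuQ_i(t,u)\right)^2,$$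 with the same conditions as in (1). -/

import Mathlib

namespace BrownSquare

/-- The variable `t` of `K[[t]][u]`. -/
noncomputable def tVar (K : Type*) [Field K] : Polynomial (PowerSeries K) :=
  Polynomial.C PowerSeries.X

/-- The variable `u` of `K[[t]][u]`. -/
noncomputable def uVar (K : Type*) [Field K] : Polynomial (PowerSeries K) :=
  Polynomial.X

/-- The inclusion of `K[[t]][u]` in `K[u][[t]]`: it sends `t` to `t` and `u` to `u`
(the coefficient of `t^n u^m` is unchanged). -/
noncomputable def toPolySeries (K : Type*) [Field K] :
    Polynomial (PowerSeries K) →+* PowerSeries (Polynomial K) :=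
  Polynomial.eval₂RingHom (PowerSeries.map Polynomial.C) (PowerSeries.C Polynomial.X)

/-- The inclusion of `K[[t]][u]` in `K̄[[t]][u]`, where `K̄` is the algebraic closure of `K`. -/
noncomputable def baseChange (K : Type*) [Field K] :
    Polynomial (PowerSeries K) →+* Polynomial (PowerSeries (AlgebraicClosure K)) :=
  Polynomial.mapRingHom (PowerSeries.map (algebraMap K (AlgebraicClosure K)))

/-- `Δ` has a square root in `K[[t,u]] = K[[t]][[u]]`. -/
def HasSqrtInSeries {K : Type*} [Field K] (Δ : Polynomial (PowerSeries K)) : Prop :=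
  ∃ δ : PowerSeries (PowerSeries K), (Δ : PowerSeries (PowerSeries K)) = δ ^ 2

/-- `Δ` has a square root in `K[u][[t]]`. -/
def HasSqrtInPolySeries {K : Type*} [Field K] (Δ : Polynomial (PowerSeries K)) : Prop :=
  ∃ δ : PowerSeries (Polynomial K), toPolySeries K Δ = δ ^ 2

/-- The element `1 + t S(t)`. -/
noncomputable def unitFactor {K : Type*} [Field K] (S : PowerSeries K) :
    Polynomial (PowerSeries K) :=
  1 + tVar K * Polynomial.C S

/-- The factor `1 + t u R₁(t,u)`. -/
noncomputable def infFactor {K : Type*} [Field K] (R₁ : Polynomial (PowerSeries K)) :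
    Polynomial (PowerSeries K) :=
  1 + tVar K * uVar K * R₁

/-- The factor `u^d + t R₂(t,u)`. -/
noncomputable def zeroFactor {K : Type*} [Field K] (d : ℕ) (R₂ : Polynomial (PowerSeries K)) :
    Polynomial (PowerSeries K) :=
  uVar K ^ d + tVar K * R₂

/-- The factor `(1 - u/α)^e + t u Q(t,u)` (used for `α ≠ 0` only). -/
noncomputable def finFactor {L : Type*} [Field L] (α : L) (e : ℕ)
    (Q : Polynomial (PowerSeries L)) : Polynomial (PowerSeries L) :=
  (1 - Polynomial.C (PowerSeries.C α⁻¹) * uVar L) ^ e + tVar L * uVar L * Q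

end BrownSquare

open IsLocalRing Polynomial

namespace PowerSeries

/-! ### Completeness of the ring of formal power series over a field. -/

section AdicComplete

variable {k : Type*} [Field k]

/-! `K[[t]]` is a complete local ring, so Weierstrass preparation splits a polynomial in `u`
according to the residues of its roots at `t = 0`: zero, infinity, or some `α ≠ 0`. Since `t` is
prime in `K[[t,u]]`, it divides a square to an even power, which gives `t^(2p)`. The remaining
square root is `P v` with `P` distinguished and `v` a unit. So `P ^ 2` is the factor at zero, and `v
^ 2` is again a polynomial, whose constant term is a square and yields `c^2 (1 + tS)`. Preparing the
reversed polynomial isolates the roots at infinity. What is left keeps its degree at `t = 0`; over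
the algebraic closure, preparation after each shift `u ↦ u + α` exhausts it.

For (2), the shift `u ↦ u + α` makes sense on `K[u][[t]]`, though not on `K[[t,u]]`. Hence the
shifted `Δ` is still a square of a power series, and uniqueness in Weierstrass preparation makes
each distinguished factor a square (`exists_eq_sq`). -/

theorem smodEq_maximalIdeal_pow_iff (n : ℕ) (x y : k⟦X⟧) :
    x ≡ y [SMOD (maximalIdeal k⟦X⟧ ^ n • ⊤ : Submodule k⟦X⟧ k⟦X⟧)] ↔
      ∀ m < n, coeff m x = coeff m y := by
  rw [SModEq.sub_mem, smul_eq_mul, Ideal.mul_top, maximalIdeal_eq_span_X, Ideal.span_singleton_pow,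
    Ideal.mem_span_singleton, X_pow_dvd_iff]
  simp [sub_eq_zero]

instance isAdicComplete_maximalIdeal : IsAdicComplete (maximalIdeal k⟦X⟧) k⟦X⟧ where
  haus' x hx := by
    ext m
    exact (smodEq_maximalIdeal_pow_iff (m + 1) x 0).1 (hx (m + 1)) m (Nat.lt_succ_self m)
  prec' f hf := by
    -- The coefficient of index `m` is stable from `f (m + 1)` on.
    refine ⟨mk fun m ↦ coeff m (f (m + 1)), fun n ↦ ?_⟩
    rw [smodEq_maximalIdeal_pow_iff]
    intro m hm
    rw [coeff_mk]
    exact ((smodEq_maximalIdeal_pow_iff (m + 1) _ _).1 (hf (Nat.succ_le_of_lt hm)) m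
      (Nat.lt_succ_self m)).symm

theorem mem_maximalIdeal_iff_constantCoeff (x : k⟦X⟧) :
    x ∈ maximalIdeal k⟦X⟧ ↔ constantCoeff x = 0 := by
  rw [maximalIdeal_eq_span_X, Ideal.mem_span_singleton, X_dvd_iff]

end AdicComplete

/-! ### Consequences of uniqueness in Weierstrass division and preparation. -/

section Weierstrass

variable {A : Type*} [CommRing A] [IsLocalRing A] [IsAdicComplete (maximalIdeal A) A]

/-- If a distinguished polynomial divides a polynomial as a power series, then the quotient is a
polynomial. -/
theorem exists_polynomial_eq_of_isDistinguishedAt_mul {P f : A[X]} {h : A⟦X⟧}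
    (hP : P.IsDistinguishedAt (maximalIdeal A)) (hf : (f : A⟦X⟧) = P * h) :
    ∃ g : A[X], f = P * g ∧ (g : A⟦X⟧) = h := by
  have hdeg : P.natDegree = ((P : A⟦X⟧).map (Ideal.Quotient.mk (maximalIdeal A))).order.toNat := by
    rw [← hP.coe_natDegree_eq_order_map (P : A⟦X⟧) 1 (by simp) (by simp), ENat.toNat_natCast]
  -- Euclidean division by the monic `P` and `f = P * h + 0` are both Weierstrass divisions, so they
  -- agree.
  have key := hP.isWeierstrassDivisorAt'.eq_of_mul_add_eq_mul_add
    (q := (f /ₘ P : A[X])) (q' := h) (r := f %ₘ P) (r' := 0) (by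
      rw [← hdeg, ← degree_eq_natDegree hP.monic.ne_zero]
      exact degree_modByMonic_lt f hP.monic) (by simp) (by
      rw [Polynomial.coe_zero, add_zero, ← hf, ← Polynomial.coe_mul, ← Polynomial.coe_add, add_comm,
        modByMonic_add_div])
  refine ⟨f /ₘ P, ?_, key.1⟩
  conv_lhs => rw [← modByMonic_add_div f P, key.2, zero_add]

/-- Weierstrass preparation for a polynomial: the unit is a polynomial too. -/
theorem _root_.Polynomial.exists_isDistinguishedAt_mul {f : A[X]} (hf : f.map (residue A) ≠ 0) :
    ∃ P g : A[X], P.IsDistinguishedAt (maximalIdeal A) ∧ IsUnit (g.coeff 0) ∧ f = P * g := by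
  obtain ⟨P, h, H⟩ := exists_isWeierstrassFactorization (g := (f : A⟦X⟧)) (by
    rw [← polynomial_map_coe]
    exact_mod_cast hf)
  obtain ⟨g, hg, rfl⟩ := exists_polynomial_eq_of_isDistinguishedAt_mul H.isDistinguishedAt H.eq_mul
  refine ⟨P, g, H.isDistinguishedAt, ?_, hg⟩
  simpa using isUnit_iff_constantCoeff.1 H.isUnit

/-- Squaring the Weierstrass factorization of `δ` gives one of `δ ^ 2`, and the factorization is
unique. -/
theorem _root_.Polynomial.IsDistinguishedAt.exists_eq_sq {P : A[X]} {h δ : A⟦X⟧}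
    (hP : P.IsDistinguishedAt (maximalIdeal A)) (hh : IsUnit h) (hδ : P * h = δ ^ 2) :
    ∃ Q : A[X], Q.IsDistinguishedAt (maximalIdeal A) ∧ P = Q ^ 2 := by
  have H : (δ ^ 2).IsWeierstrassFactorization P h := ⟨hP, hh, hδ.symm⟩
  have hδ0 : δ.map (residue A) ≠ 0 := fun h0 ↦ H.map_ne_zero (by rw [map_pow, h0]; simp)
  obtain ⟨Q, v, HQ⟩ := exists_isWeierstrassFactorization hδ0
  refine ⟨Q, HQ.isDistinguishedAt, ?_⟩
  rw [sq] at H ⊢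
  exact (H.elim (HQ.mul HQ)).1

end Weierstrass

/-! ### Exchange of the two variables. -/

section Swap

variable {R : Type*} [CommSemiring R]

/-- Exchanging the two variables of an iterated power series ring. -/
noncomputable def swapVars : R⟦X⟧⟦X⟧ →+* R⟦X⟧⟦X⟧ where
  toFun f := mk fun n ↦ mk fun m ↦ coeff n (coeff m f)
  map_one' := by
    ext n m
    simp only [coeff_mk, coeff_one]
    split_ifs <;> simp_all [coeff_one]
  map_zero' := by ext; simp
  map_add' f g := by ext; simp
  map_mul' f g := by
    ext n m
    simp only [coeff_mk, coeff_mul, map_sum]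
    exact Finset.sum_comm

@[simp]
theorem coeff_coeff_swapVars (f : R⟦X⟧⟦X⟧) (n m : ℕ) :
    coeff m (coeff n (swapVars f)) = coeff n (coeff m f) := by
  simp [swapVars]

@[simp]
theorem swapVars_C (f : R⟦X⟧) : swapVars (C f) = f.map C := by
  ext n m
  rw [coeff_coeff_swapVars, coeff_map, coeff_C, coeff_C]
  split_ifs <;> simp

@[simp]
theorem swapVars_map_C (f : R⟦X⟧) : swapVars (f.map C) = C f := by
  ext n m
  rw [coeff_coeff_swapVars, coeff_map, coeff_C, coeff_C]
  split_ifs <;> simp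

end Swap

/-! ### Primality of `t` in `K[[t]][[u]]`. -/

section CX

variable {k : Type*} [Field k]

theorem C_X_dvd_iff (f : k⟦X⟧⟦X⟧) : C (X : k⟦X⟧) ∣ f ↔ f.map constantCoeff = 0 := by
  constructor
  · rintro ⟨g, rfl⟩
    simp
  · intro h
    have h' (n : ℕ) : (X : k⟦X⟧) ∣ coeff n f := by
      rw [X_dvd_iff, ← coeff_map, h, map_zero]
    choose g hg using h'
    exact ⟨mk g, by ext1 n; simp [hg]⟩

theorem prime_C_X : Prime (C (X : k⟦X⟧) : k⟦X⟧⟦X⟧) := by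
  refine ⟨?_, ?_, fun a b ↦ ?_⟩
  · rw [Ne, map_eq_zero_iff _ C_injective]
    exact X_ne_zero
  · rw [isUnit_iff_constantCoeff, constantCoeff_C]
    exact X_prime.not_isUnit
  · simp only [C_X_dvd_iff, map_mul, mul_eq_zero]
    exact id

theorem exists_sq_of_C_X_pow_mul {a δ : k⟦X⟧⟦X⟧} (p : ℕ) (h : C (X : k⟦X⟧) ^ (2 * p) * a = δ ^ 2) :
    ∃ δ' : k⟦X⟧⟦X⟧, a = δ' ^ 2 := by
  induction p generalizing δ with
  | zero => exact ⟨δ, by simpa using h⟩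
  | succ p ih =>
    obtain ⟨δ', rfl⟩ : C (X : k⟦X⟧) ∣ δ := by
      refine prime_C_X.dvd_of_dvd_pow (n := 2) ?_
      rw [← h]
      exact Dvd.dvd.mul_right (dvd_pow_self _ (by omega)) _
    refine ih (δ := δ') (mul_left_cancel₀ (pow_ne_zero 2 prime_C_X.ne_zero) ?_)
    rw [← mul_pow, ← h]
    ring

end CX

end PowerSeries

namespace BrownSquare

open scoped PowerSeries

/-! ### Reduction at `t = 0`, normal forms of the factors, roots at infinity. -/

section Reduction

variable {k : Type*} [Field k]

theorem map_residue_ne_zero {f : k⟦X⟧[X]} (hf : f.map PowerSeries.constantCoeff ≠ 0) :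
    f.map (residue k⟦X⟧) ≠ 0 := by
  contrapose! hf
  ext n
  have := congr(coeff $hf n)
  rw [coeff_map, coeff_zero, residue_eq_zero_iff,
    PowerSeries.mem_maximalIdeal_iff_constantCoeff] at this
  rw [coeff_map, this, coeff_zero]

theorem map_constantCoeff_eq_X_pow {P : k⟦X⟧[X]} (hP : P.IsDistinguishedAt (maximalIdeal k⟦X⟧)) :
    P.map PowerSeries.constantCoeff = X ^ P.natDegree := by
  ext i
  rw [coeff_map, coeff_X_pow]
  split_ifs with h
  · rw [h, hP.monic.coeff_natDegree, map_one]
  · rcases lt_or_gt_of_ne h with h | h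
    · exact (PowerSeries.mem_maximalIdeal_iff_constantCoeff _).1 (hP.mem h)
    · rw [coeff_eq_zero_of_natDegree_lt h, map_zero]

theorem exists_eq_tVar_mul {f : k⟦X⟧[X]} (hf : f.map PowerSeries.constantCoeff = 0) :
    ∃ R : k⟦X⟧[X], f = tVar k * R ∧ R.degree = f.degree := by
  have h : tVar k ∣ f := by
    rw [tVar, C_dvd_iff_dvd_coeff]
    intro n
    rw [PowerSeries.X_dvd_iff, ← coeff_map, hf, coeff_zero]
  obtain ⟨R, rfl⟩ := h
  exact ⟨R, rfl, by rw [tVar, degree_C_mul PowerSeries.X_ne_zero]⟩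

theorem exists_eq_tVar_mul_uVar_mul {f : k⟦X⟧[X]} (hf : f.map PowerSeries.constantCoeff = 0)
    (hf0 : f.coeff 0 = 0) :
    ∃ R : k⟦X⟧[X], f = tVar k * uVar k * R ∧ (uVar k * R).degree = f.degree := by
  obtain ⟨R', rfl, hdeg⟩ := exists_eq_tVar_mul hf
  rw [tVar, coeff_C_mul, mul_eq_zero, or_iff_right PowerSeries.X_ne_zero, ← X_dvd_iff] at hf0
  obtain ⟨R, rfl⟩ := hf0
  exact ⟨R, by rw [uVar, mul_assoc], hdeg⟩

@[simp]
theorem map_constantCoeff_tVar : (tVar k).map PowerSeries.constantCoeff = 0 := by simp [tVar]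

@[simp]
theorem map_constantCoeff_uVar : (uVar k).map PowerSeries.constantCoeff = X := by simp [uVar]

@[simp]
theorem map_constantCoeff_unitFactor (S : k⟦X⟧) : (unitFactor S).map PowerSeries.constantCoeff = 1 := by
  simp [unitFactor]

@[simp]
theorem map_constantCoeff_infFactor (R : k⟦X⟧[X]) : (infFactor R).map PowerSeries.constantCoeff = 1 := by
  simp [infFactor]

@[simp]
theorem map_constantCoeff_zeroFactor (d : ℕ) (R : k⟦X⟧[X]) :
    (zeroFactor d R).map PowerSeries.constantCoeff = X ^ d := by
  simp [zeroFactor]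

@[simp]
theorem coeff_zero_finFactor (α : k) (e : ℕ) (Q : k⟦X⟧[X]) : (finFactor α e Q).coeff 0 = 1 := by
  simp [finFactor, uVar, coeff_zero_eq_eval_zero]

theorem exists_eq_infFactor {f : k⟦X⟧[X]} (hf : f.map PowerSeries.constantCoeff = 1) (hf0 : f.coeff 0 = 1) :
    ∃ R, f = infFactor R := by
  obtain ⟨R, hR, -⟩ := exists_eq_tVar_mul_uVar_mul (f := f - 1) (by simp [hf]) (by simp [hf0])
  exact ⟨R, by rw [infFactor, ← hR, add_sub_cancel]⟩

theorem exists_eq_zeroFactor {P : k⟦X⟧[X]} (hP : P.IsDistinguishedAt (maximalIdeal k⟦X⟧)) :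
    ∃ R : k⟦X⟧[X], R.degree < (P.natDegree : WithBot ℕ) ∧ P = zeroFactor P.natDegree R := by
  obtain ⟨R, hR, hdeg⟩ := exists_eq_tVar_mul (f := P - X ^ P.natDegree)
    (by simp [map_constantCoeff_eq_X_pow hP])
  refine ⟨R, ?_, by rw [zeroFactor, ← hR, uVar, add_sub_cancel]⟩
  have h := degree_eq_natDegree hP.monic.ne_zero
  rw [hdeg, ← h]
  exact degree_sub_lt_left (by rw [degree_X_pow, h]) hP.monic.ne_zero
    (by rw [leadingCoeff_X_pow, hP.monic.leadingCoeff])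

theorem exists_eq_finFactor {f : k⟦X⟧[X]} {α : k} {e : ℕ} (hdeg : f.natDegree ≤ e)
    (hf : f.map PowerSeries.constantCoeff = (1 - C α⁻¹ * X) ^ e) (hf0 : f.coeff 0 = 1) :
    ∃ Q : k⟦X⟧[X], Q.degree < (e : WithBot ℕ) ∧ f = finFactor α e Q := by
  obtain ⟨Q, hQ, hQdeg⟩ := exists_eq_tVar_mul_uVar_mul
    (f := f - (1 - C (PowerSeries.C α⁻¹) * uVar k) ^ e) (by simp [hf])
    (by rw [coeff_sub, hf0]; simp [uVar, coeff_zero_eq_eval_zero])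
  refine ⟨Q, ?_, by rw [finFactor, ← hQ, add_sub_cancel]⟩
  rcases eq_or_ne Q 0 with rfl | hQ0
  · exact degree_zero.trans_lt (WithBot.bot_lt_coe _)
  -- The factor `u` in front of `Q` turns the bound `≤ e` into `deg Q < e`.
  have h1 : (uVar k * Q).degree ≤ (e : WithBot ℕ) := by
    rw [hQdeg]
    refine (degree_sub_le _ _).trans (max_le (degree_le_of_natDegree_le hdeg) ?_)
    refine degree_le_of_natDegree_le (natDegree_pow_le_of_le e (m := 1) ?_ |>.trans (by simp))
    rw [uVar]
    compute_degree
  rw [uVar, degree_mul, degree_X, degree_eq_natDegree hQ0] at h1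
  rw [degree_eq_natDegree hQ0]
  norm_cast at h1 ⊢
  omega

theorem reverse_reverse_of_coeff_zero_ne {f : k⟦X⟧[X]} (hf : f.coeff 0 ≠ 0) :
    f.reverse.reverse = f := by
  have h : f.reverse.natDegree = f.natDegree := by
    rw [reverse_natDegree, natTrailingDegree_eq_zero.2 (Or.inr hf), Nat.sub_zero]
  rw [reverse, h, reverse, reflect_reflect]

/-- Splitting off the roots at infinity of a polynomial with constant coefficient `1`. -/
theorem exists_eq_infFactor_mul {f : k⟦X⟧[X]} (hf0 : f.coeff 0 = 1) :
    ∃ R F : k⟦X⟧[X], f = infFactor R * F ∧ F.coeff 0 = 1 ∧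
      F.natDegree ≤ (F.map PowerSeries.constantCoeff).natDegree := by
  have hmonic : f.reverse.Monic := by
    rw [Monic, reverse_leadingCoeff, trailingCoeff,
      natTrailingDegree_eq_zero.2 (Or.inr (by rw [hf0]; exact one_ne_zero)), hf0]
  obtain ⟨P, W, hP, hW, hPW⟩ := Polynomial.exists_isDistinguishedAt_mul
    (map_residue_ne_zero (hmonic.map PowerSeries.constantCoeff).ne_zero)
  have hWm : W.Monic := hP.monic.of_mul_monic_left (hPW ▸ hmonic)
  have hfac : f = P.reverse * W.reverse := by
    rw [← reverse_mul_of_domain, ← hPW,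
      reverse_reverse_of_coeff_zero_ne (by rw [hf0]; exact one_ne_zero)]
  obtain ⟨R, hR⟩ := exists_eq_infFactor (f := P.reverse) (by
      ext i
      rw [coeff_map, coeff_reverse, coeff_one]
      split_ifs with hi
      · simp [hi, hP.monic]
      · rcases le_or_gt i P.natDegree with h | h
        · rw [revAt_le h]
          exact (PowerSeries.mem_maximalIdeal_iff_constantCoeff _).1 (hP.mem (by omega))
        · rw [revAt_eq_self_of_lt h, coeff_eq_zero_of_natDegree_lt h, map_zero])
    (by rw [coeff_zero_reverse, hP.monic.leadingCoeff])
  refine ⟨R, W.reverse, by rw [hfac, hR], by rw [coeff_zero_reverse, hWm.leadingCoeff], ?_⟩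
  -- The coefficient of `W.reverse` in degree `W.natDegree` is `W.coeff 0`, a unit, so it survives
  -- at `t = 0`.
  refine (reverse_natDegree_le W).trans (le_natDegree_of_ne_zero ?_)
  rw [coeff_map, coeff_reverse, revAt_le le_rfl, Nat.sub_self]
  exact (hW.map PowerSeries.constantCoeff).ne_zero

end Reduction

/-! ### Factors at finite nonzero residues. -/

section FiniteRoots

variable {L : Type*} [Field L]

theorem map_taylor_constantCoeff_of_isDistinguishedAt {P : L⟦X⟧[X]}
    (hP : P.IsDistinguishedAt (maximalIdeal L⟦X⟧)) (α : L) :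
    (taylor (-PowerSeries.C α) P).map PowerSeries.constantCoeff = (X - C α) ^ P.natDegree := by
  rw [map_taylor, map_constantCoeff_eq_X_pow hP]
  simp [sub_eq_add_neg]

/-- At `t = 0` the shifted polynomial is a power of `u - α`. As `α ≠ 0`, its constant term is a unit
`v` and can be divided out. -/
theorem exists_taylor_eq_finFactor {P : L⟦X⟧[X]} (hP : P.IsDistinguishedAt (maximalIdeal L⟦X⟧))
    {α : L} (hα : α ≠ 0) :
    ∃ (v : L⟦X⟧) (Q : L⟦X⟧[X]), Q.degree < (P.natDegree : WithBot ℕ) ∧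
      taylor (-PowerSeries.C α) P = C v * finFactor α P.natDegree Q := by
  set f := taylor (-PowerSeries.C α) P with hf
  have hmap : f.map PowerSeries.constantCoeff = (X - C α) ^ P.natDegree :=
    map_taylor_constantCoeff_of_isDistinguishedAt hP α
  have hv : PowerSeries.constantCoeff (f.coeff 0) = (-α) ^ P.natDegree := by
    rw [← coeff_map, hmap, coeff_zero_eq_eval_zero]
    simp
  have hv0 : PowerSeries.constantCoeff (f.coeff 0) ≠ 0 := by
    rw [hv]
    exact pow_ne_zero _ (neg_ne_zero.2 hα)
  obtain ⟨Q, hQ, hfQ⟩ := exists_eq_finFactor (f := C (f.coeff 0)⁻¹ * f) (α := α)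
    ((natDegree_C_mul_le _ _).trans (natDegree_taylor _ _).le) (by
      rw [Polynomial.map_mul, map_C, PowerSeries.constantCoeff_inv, hmap, hv, ← inv_pow, C_pow,
        ← mul_pow]
      congr 1
      rw [mul_sub, ← C_mul, inv_mul_eq_div, div_neg, div_self hα, inv_neg]
      simp only [C_neg, C_1]
      ring)
    (by rw [coeff_C_mul, PowerSeries.inv_mul_cancel _ hv0])
  refine ⟨f.coeff 0, Q, hQ, ?_⟩
  rw [← hfQ, ← mul_assoc, ← C_mul, PowerSeries.mul_inv_cancel _ hv0, C_1, one_mul]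

/-- Splitting off the roots that reduce to elements of a given finite set. -/
theorem exists_eq_prod_taylor_mul {F : L⟦X⟧[X]} (hF : F.map PowerSeries.constantCoeff ≠ 0) (s : Finset L) :
    ∃ (P : L → L⟦X⟧[X]) (U : L⟦X⟧[X]),
      (∀ α ∈ s, (P α).IsDistinguishedAt (maximalIdeal L⟦X⟧) ∧
        (U.map PowerSeries.constantCoeff).eval α ≠ 0) ∧
      F = (∏ α ∈ s, taylor (-PowerSeries.C α) (P α)) * U := by
  classical
  induction s using Finset.induction_on with
  | empty => exact ⟨0, F, by simp, by simp⟩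
  | insert a s ha ih =>
    obtain ⟨P, U, hPU, rfl⟩ := ih
    have hU : U.map PowerSeries.constantCoeff ≠ 0 := by
      rintro h
      exact hF (by rw [Polynomial.map_mul, h, mul_zero])
    obtain ⟨P', g, hP', hg, hPg⟩ := Polynomial.exists_isDistinguishedAt_mul
      (f := taylor (PowerSeries.C a) U) (map_residue_ne_zero (by
        rwa [map_taylor, Ne, taylor_eq_zero]))
    have hUeq : U = taylor (-PowerSeries.C a) P' * taylor (-PowerSeries.C a) g := by
      rw [← taylor_mul, ← hPg, taylor_taylor, neg_add_cancel, taylor_zero]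
    refine ⟨Function.update P a P', taylor (-PowerSeries.C a) g, fun α hα ↦ ?_, ?_⟩
    · rcases eq_or_ne α a with rfl | hne
      · refine ⟨by simpa using hP', ?_⟩
        rw [map_taylor, taylor_eval]
        simpa [coeff_zero_eq_eval_zero, ← coeff_map] using (hg.map PowerSeries.constantCoeff).ne_zero
      · have hα' := hPU α ((Finset.mem_insert.1 hα).resolve_left hne)
        refine ⟨by simpa [hne] using hα'.1, fun h0 ↦ hα'.2 ?_⟩
        rw [hUeq, Polynomial.map_mul, eval_mul, h0, mul_zero]
    · rw [Finset.prod_insert ha, Function.update_self]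
      conv_lhs => rw [hUeq]
      have hprod : ∏ α ∈ s, taylor (-PowerSeries.C α) (Function.update P a P' α) =
          ∏ α ∈ s, taylor (-PowerSeries.C α) (P α) :=
        Finset.prod_congr rfl fun α hα ↦ by
          rw [Function.update_of_ne (ne_of_mem_of_not_mem hα ha)]
      rw [hprod]
      ring

variable [IsAlgClosed L]

/-- Take for `s` the roots of the reduction. The cofactor left over has a reduction without roots,
hence constant; the degree hypothesis then makes the cofactor itself constant. -/
theorem exists_eq_C_mul_prod_taylor {F : L⟦X⟧[X]} (hF0 : F.coeff 0 = 1)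
    (hdeg : F.natDegree ≤ (F.map PowerSeries.constantCoeff).natDegree) :
    ∃ (s : Finset L) (P : L → L⟦X⟧[X]) (w : L⟦X⟧),
      (∀ α ∈ s, α ≠ 0 ∧ 0 < (P α).natDegree ∧ (P α).IsDistinguishedAt (maximalIdeal L⟦X⟧) ∧
        ∃ G, F = taylor (-PowerSeries.C α) (P α) * G ∧ (G.map PowerSeries.constantCoeff).eval α ≠ 0) ∧
      F = C w * ∏ α ∈ s, taylor (-PowerSeries.C α) (P α) := by
  classical
  have hred0 : (F.map PowerSeries.constantCoeff).coeff 0 = 1 := by rw [coeff_map, hF0, map_one]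
  have hred : F.map PowerSeries.constantCoeff ≠ 0 := by
    rintro h
    simp [h] at hred0
  set s := (F.map PowerSeries.constantCoeff).roots.toFinset with hs
  have hmem (α : L) : α ∈ s ↔ (F.map PowerSeries.constantCoeff).eval α = 0 := by
    rw [hs, Multiset.mem_toFinset, mem_roots hred, IsRoot.def]
  obtain ⟨P, U, hPU, hF⟩ := exists_eq_prod_taylor_mul hred s
  have hmapF := congr(Polynomial.map PowerSeries.constantCoeff $hF)
  rw [Polynomial.map_mul, Polynomial.map_prod, Finset.prod_congr rfl fun α hα ↦
    map_taylor_constantCoeff_of_isDistinguishedAt (hPU α hα).1 α] at hmapF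
  have hU0 : U.map PowerSeries.constantCoeff ≠ 0 := by
    rintro h
    exact hred (by rw [hmapF, h, mul_zero])
  have hUdeg : (U.map PowerSeries.constantCoeff).natDegree = 0 := by
    by_contra h
    obtain ⟨α, hα⟩ := IsAlgClosed.exists_root (U.map PowerSeries.constantCoeff)
      (fun h' ↦ h (natDegree_eq_of_degree_eq_some h'))
    have hαs : α ∈ s := by rw [hmem, hmapF, eval_mul, hα, mul_zero]
    exact (hPU α hαs).2 hα
  set M := ∏ α ∈ s, taylor (-PowerSeries.C α) (P α) with hM
  have hmonic : M.Monic := monic_prod_of_monic _ _ fun α hα ↦ by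
    rw [Monic, leadingCoeff_taylor, (hPU α hα).1.monic.leadingCoeff]
  have hUnat : U.natDegree = 0 := by
    have hUne : U ≠ 0 := by
      rintro rfl
      simp at hU0
    have h2 : (F.map PowerSeries.constantCoeff).natDegree ≤ M.natDegree := by
      rw [hF, Polynomial.map_mul]
      refine natDegree_mul_le.trans ?_
      rw [hUdeg, add_zero]
      exact natDegree_map_le
    rw [hF, hmonic.natDegree_mul' hUne, ← hF] at hdeg
    omega
  rw [natDegree_eq_zero] at hUnat
  obtain ⟨w, rfl⟩ := hUnat
  refine ⟨s, P, w, fun α hα ↦ ?_, by rw [mul_comm]; exact hF⟩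
  have hG : ((((∏ β ∈ s.erase α, taylor (-PowerSeries.C β) (P β)) * C w).map
      PowerSeries.constantCoeff).eval α) ≠ 0 := by
    rw [Polynomial.map_mul, eval_mul, Polynomial.map_prod, eval_prod]
    refine mul_ne_zero (Finset.prod_ne_zero_iff.2 fun β hβ ↦ ?_) (hPU α hα).2
    rw [Finset.mem_erase] at hβ
    rw [map_taylor_constantCoeff_of_isDistinguishedAt (hPU β hβ.2).1]
    simpa using pow_ne_zero _ (sub_ne_zero.2 hβ.1.symm)
  have hFG : F = taylor (-PowerSeries.C α) (P α) *
      ((∏ β ∈ s.erase α, taylor (-PowerSeries.C β) (P β)) * C w) := by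
    rw [← mul_assoc, Finset.mul_prod_erase s (fun β ↦ taylor (-PowerSeries.C β) (P β)) hα]
    exact hF
  refine ⟨?_, ?_, (hPU α hα).1, _, hFG, hG⟩
  · rintro rfl
    rw [hmem, ← coeff_zero_eq_eval_zero, hred0] at hα
    exact one_ne_zero hα
  · rw [Nat.pos_iff_ne_zero]
    intro h0
    have h := (hmem α).1 hα
    rw [hFG, Polynomial.map_mul, eval_mul,
      map_taylor_constantCoeff_of_isDistinguishedAt (hPU α hα).1, h0, pow_zero, eval_one,
      one_mul] at h
    exact hG h

/-- The exponent `m` serves both parts: `m = 1`, where `hpow` is trivial, and `m = 2`. -/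
theorem exists_eq_prod_finFactor (m : ℕ) {F : L⟦X⟧[X]} (hF0 : F.coeff 0 = 1)
    (hdeg : F.natDegree ≤ (F.map PowerSeries.constantCoeff).natDegree)
    (hpow : ∀ (α : L) (P G : L⟦X⟧[X]), α ≠ 0 → P.IsDistinguishedAt (maximalIdeal L⟦X⟧) →
      F = taylor (-PowerSeries.C α) P * G → (G.map PowerSeries.constantCoeff).eval α ≠ 0 →
      ∃ P' : L⟦X⟧[X], P'.IsDistinguishedAt (maximalIdeal L⟦X⟧) ∧ P = P' ^ m) :
    ∃ (k : ℕ) (α : Fin k → L) (e : Fin k → ℕ) (Q : Fin k → L⟦X⟧[X]),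
      Function.Injective α ∧
      (∀ i, α i ≠ 0 ∧ 0 < e i ∧ (Q i).degree < (e i : WithBot ℕ)) ∧
      F = ∏ i, finFactor (α i) (e i) (Q i) ^ m := by
  obtain ⟨s, P, w, hs, hF⟩ := exists_eq_C_mul_prod_taylor hF0 hdeg
  have key (α : s) : ∃ (e : ℕ) (v : L⟦X⟧) (Q : L⟦X⟧[X]), 0 < e ∧ Q.degree < (e : WithBot ℕ) ∧
      taylor (-PowerSeries.C α.1) (P α) = C v * finFactor α.1 e Q ^ m := by
    obtain ⟨hα, hpos, hP, G, hG, hG0⟩ := hs α α.2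
    obtain ⟨P', hP', hPP'⟩ := hpow α (P α) G hα hP hG hG0
    have hpos' : 0 < P'.natDegree := by
      rw [hPP', natDegree_pow] at hpos
      exact Nat.pos_of_mul_pos_left hpos
    obtain ⟨v, Q, hQ, hv⟩ := exists_taylor_eq_finFactor hP' hα
    exact ⟨P'.natDegree, v ^ m, Q, hpos', hQ, by rw [hPP', taylor_pow, hv, mul_pow, C_pow]⟩
  choose e v Q he hQ hfac using key
  let φ := s.equivFin.symm
  refine ⟨s.card, fun i ↦ (φ i).1, fun i ↦ e (φ i), fun i ↦ Q (φ i),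
    Subtype.val_injective.comp φ.injective, fun i ↦ ⟨(hs _ (φ i).2).1, he _, hQ _⟩, ?_⟩
  rw [← Finset.prod_coe_sort, Finset.prod_congr rfl fun α _ ↦ hfac α, Finset.prod_mul_distrib,
    ← map_prod, ← mul_assoc, ← C_mul,
    ← φ.prod_comp fun α ↦ finFactor α.1 (e α) (Q α) ^ m] at hF
  -- Constant terms in `u` show that the collected scalar is `1`.
  have hw := congr(coeff $hF 0)
  rw [hF0, coeff_C_mul, coeff_zero_prod] at hw
  simp only [coeff_zero_eq_eval_zero, eval_pow] at hw
  simp only [← coeff_zero_eq_eval_zero, coeff_zero_finFactor, one_pow, Finset.prod_const_one,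
    mul_one] at hw
  rwa [← hw, C_1, one_mul] at hF

end FiniteRoots

/-! ### Use of the square root. -/

section SquareRoot

variable {K : Type*} [Field K]

theorem exists_eq_tVar_pow_mul {Δ : K⟦X⟧[X]} (h0 : Δ ≠ 0) {δ : K⟦X⟧⟦X⟧}
    (hδ : (Δ : K⟦X⟧⟦X⟧) = δ ^ 2) :
    ∃ (p : ℕ) (Δ' : K⟦X⟧[X]) (δ' : K⟦X⟧⟦X⟧), Δ = tVar K ^ (2 * p) * Δ' ∧
      (Δ' : K⟦X⟧⟦X⟧) = δ' ^ 2 ∧ δ'.map PowerSeries.constantCoeff ≠ 0 := by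
  have hδ0 : δ ≠ 0 := by
    rintro rfl
    refine h0 (Polynomial.coe_injective _ ?_)
    rw [hδ, Polynomial.coe_zero, zero_pow two_ne_zero]
  obtain ⟨δ', hδ', hnd⟩ :=
    (FiniteMultiplicity.of_prime_left PowerSeries.prime_C_X hδ0).exists_eq_pow_mul_and_not_dvd
  set p := multiplicity (PowerSeries.C (PowerSeries.X : K⟦X⟧)) δ
  have hsq : (Δ : K⟦X⟧⟦X⟧) = PowerSeries.C (PowerSeries.X ^ (2 * p)) * δ' ^ 2 := by
    rw [hδ, hδ', map_pow]
    ring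
  obtain ⟨Δ', hΔ'⟩ : tVar K ^ (2 * p) ∣ Δ := by
    rw [tVar, ← C_pow, C_dvd_iff_dvd_coeff]
    intro n
    rw [← Polynomial.coeff_coe, hsq, PowerSeries.coeff_C_mul]
    exact dvd_mul_right _ _
  refine ⟨p, Δ', δ', hΔ', ?_, by rwa [Ne, ← PowerSeries.C_X_dvd_iff]⟩
  refine mul_left_cancel₀ (pow_ne_zero (2 * p) PowerSeries.prime_C_X.ne_zero) ?_
  rw [← map_pow, ← hsq, hΔ', tVar, ← C_pow, Polynomial.coe_mul, Polynomial.coe_C]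

theorem exists_eq_mul_of_hasSqrtInSeries {Δ : K⟦X⟧[X]} (h0 : Δ ≠ 0) (h : HasSqrtInSeries Δ) :
    ∃ (p d : ℕ) (c : K) (S : K⟦X⟧) (R₁ R₂ F : K⟦X⟧[X]), c ≠ 0 ∧ R₂.degree < (d : WithBot ℕ) ∧
      F.coeff 0 = 1 ∧ F.natDegree ≤ (F.map PowerSeries.constantCoeff).natDegree ∧
      Δ = C (PowerSeries.C c) ^ 2 * tVar K ^ (2 * p) * unitFactor S * infFactor R₁ *
        zeroFactor d R₂ ^ 2 * F := by
  obtain ⟨δ, hδ⟩ := h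
  obtain ⟨p, Δ', δ', hΔ, hδ', hred⟩ := exists_eq_tVar_pow_mul h0 hδ
  have hres : δ'.map (residue K⟦X⟧) ≠ 0 := by
    contrapose! hred
    ext1 n
    have := congr(PowerSeries.coeff n $hred)
    rw [PowerSeries.coeff_map, map_zero, residue_eq_zero_iff,
      PowerSeries.mem_maximalIdeal_iff_constantCoeff] at this
    rw [PowerSeries.coeff_map, this, map_zero]
  obtain ⟨P, v, H⟩ := PowerSeries.exists_isWeierstrassFactorization hres
  -- `P * P` is distinguished and divides `Δ'` with quotient `v ^ 2`, which is therefore a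
  -- polynomial `g`.
  obtain ⟨g, hg, hgv⟩ := PowerSeries.exists_polynomial_eq_of_isDistinguishedAt_mul
    (H.isDistinguishedAt.mul H.isDistinguishedAt) (f := Δ') (h := v ^ 2)
    (by rw [hδ', H.eq_mul, Polynomial.coe_mul]; ring)
  obtain ⟨R₂, hR₂, hP⟩ := exists_eq_zeroFactor H.isDistinguishedAt
  set w := PowerSeries.constantCoeff v with hw
  set c := PowerSeries.constantCoeff w with hc
  have hc0 : c ≠ 0 :=
    ((PowerSeries.isUnit_iff_constantCoeff.1 H.isUnit).map PowerSeries.constantCoeff).ne_zero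
  have hg0 : g.coeff 0 = w ^ 2 := by
    rw [← Polynomial.coeff_coe, hgv, PowerSeries.coeff_zero_eq_constantCoeff, map_pow]
  have hw2 : PowerSeries.constantCoeff (w ^ 2) ≠ 0 := by
    rw [map_pow]
    exact pow_ne_zero 2 hc0
  obtain ⟨S, hS⟩ : PowerSeries.X ∣ PowerSeries.C (c ^ 2)⁻¹ * w ^ 2 - 1 := by
    rw [PowerSeries.X_dvd_iff]
    simp [← hc, hc0]
  have hwS : w ^ 2 = PowerSeries.C c ^ 2 * (1 + PowerSeries.X * S) := by
    rw [← hS, add_sub_cancel, ← mul_assoc, ← map_pow PowerSeries.C, ← map_mul PowerSeries.C,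
      mul_inv_cancel₀ (pow_ne_zero 2 hc0), map_one, one_mul]
  obtain ⟨R₁, F, hF, hF0, hFdeg⟩ := exists_eq_infFactor_mul (f := C (w ^ 2)⁻¹ * g)
    (by rw [coeff_C_mul, hg0, PowerSeries.inv_mul_cancel _ hw2])
  have hgF : g = C (w ^ 2) * (infFactor R₁ * F) := by
    rw [← hF, ← mul_assoc, ← C_mul, PowerSeries.mul_inv_cancel _ hw2, C_1, one_mul]
  refine ⟨p, P.natDegree, c, S, R₁, R₂, F, hc0, hR₂, hF0, hFdeg, ?_⟩
  rw [← hP, hΔ, hg, hgF, hwS, unitFactor, tVar]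
  simp only [C_mul, C_pow, C_add, C_1]
  ring

/-- The substitution `u ↦ u + α` from `K[u][[t]]` to `L[[t]][[u]]`. -/
noncomputable def shiftSeries {L : Type*} [Field L] (φ : K →+* L) (α : L) :
    K[X]⟦X⟧ →+* L⟦X⟧⟦X⟧ :=
  PowerSeries.swapVars.comp (PowerSeries.map
    (eval₂RingHom ((PowerSeries.C (R := L)).comp φ) (PowerSeries.X + PowerSeries.C α)))

theorem shiftSeries_toPolySeries {L : Type*} [Field L] (φ : K →+* L) (α : L) (f : K⟦X⟧[X]) :
    shiftSeries φ α (toPolySeries K f) =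
      (taylor (PowerSeries.C α) (f.map (PowerSeries.map φ)) : L⟦X⟧[X]) := by
  -- Both sides are ring homomorphisms in `f`, so it suffices to compare them on `K[[t]]` and on
  -- `u`.
  have h : (shiftSeries φ α).comp (toPolySeries K) =
      Polynomial.coeToPowerSeries.ringHom.comp
        ((taylorAlgHom (PowerSeries.C α)).toRingHom.comp (mapRingHom (PowerSeries.map φ))) := by
    refine Polynomial.ringHom_ext (fun a ↦ ?_) ?_
    · have : PowerSeries.map (eval₂RingHom ((PowerSeries.C (R := L)).comp φ)
          (PowerSeries.X + PowerSeries.C α)) (PowerSeries.map C a) =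
          PowerSeries.map PowerSeries.C (PowerSeries.map φ a) := by
        ext1 n
        simp
      simp [shiftSeries, toPolySeries, this]
    · simp [shiftSeries, toPolySeries]
  exact congr($h f)

theorem HasSqrtInPolySeries.hasSqrtInSeries {Δ : K⟦X⟧[X]} (h : HasSqrtInPolySeries Δ) :
    HasSqrtInSeries Δ := by
  obtain ⟨δ, hδ⟩ := h
  refine ⟨shiftSeries (RingHom.id K) 0 δ, ?_⟩
  rw [← map_pow, ← hδ, shiftSeries_toPolySeries, map_zero, taylor_zero]
  congr
  ext1 n
  simp [PowerSeries.map_id]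

theorem HasSqrtInPolySeries.exists_taylor_eq_sq {Δ : K⟦X⟧[X]} (h : HasSqrtInPolySeries Δ)
    (α : AlgebraicClosure K) :
    ∃ δ : (AlgebraicClosure K)⟦X⟧⟦X⟧,
      (taylor (PowerSeries.C α) (baseChange K Δ) : (AlgebraicClosure K)⟦X⟧[X]) = δ ^ 2 := by
  obtain ⟨δ, hδ⟩ := h
  refine ⟨shiftSeries (algebraMap K (AlgebraicClosure K)) α δ, ?_⟩
  rw [← map_pow, ← hδ, shiftSeries_toPolySeries]
  rfl

end SquareRoot

/-! ### Descent of the square to the factors, and the theorem. -/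

section Main

variable {K : Type*} [Field K]

theorem map_constantCoeff_baseChange (f : K⟦X⟧[X]) :
    (baseChange K f).map PowerSeries.constantCoeff =
      (f.map PowerSeries.constantCoeff).map (algebraMap K (AlgebraicClosure K)) := by
  ext n
  simp only [baseChange, coe_mapRingHom, coeff_map,
    ← PowerSeries.coeff_zero_eq_constantCoeff_apply, PowerSeries.coeff_map]

theorem natDegree_baseChange_le {F : K⟦X⟧[X]}
    (h : F.natDegree ≤ (F.map PowerSeries.constantCoeff).natDegree) :
    (baseChange K F).natDegree ≤ ((baseChange K F).map PowerSeries.constantCoeff).natDegree := by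
  rw [map_constantCoeff_baseChange, natDegree_map]
  exact natDegree_map_le.trans h

theorem coeff_zero_baseChange {F : K⟦X⟧[X]} (h : F.coeff 0 = 1) :
    (baseChange K F).coeff 0 = 1 := by
  rw [baseChange, coe_mapRingHom, coeff_map, h, map_one]

/-- A distinguished factor of `Δ` at a nonzero residue `α` is a square. -/
theorem exists_eq_sq_of_hasSqrtInPolySeries {Δ F : K⟦X⟧[X]} {p d : ℕ} {c : K} {S : K⟦X⟧}
    {R₁ R₂ : K⟦X⟧[X]} (h : HasSqrtInPolySeries Δ) (hc : c ≠ 0)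
    (hΔ : Δ = C (PowerSeries.C c) ^ 2 * tVar K ^ (2 * p) * unitFactor S * infFactor R₁ *
      zeroFactor d R₂ ^ 2 * F)
    {α : AlgebraicClosure K} (hα : α ≠ 0) {P G : (AlgebraicClosure K)⟦X⟧[X]}
    (hP : P.IsDistinguishedAt (maximalIdeal (AlgebraicClosure K)⟦X⟧))
    (hF : baseChange K F = taylor (-PowerSeries.C α) P * G)
    (hG : (G.map PowerSeries.constantCoeff).eval α ≠ 0) :
    ∃ P' : (AlgebraicClosure K)⟦X⟧[X],
      P'.IsDistinguishedAt (maximalIdeal (AlgebraicClosure K)⟦X⟧) ∧ P = P' ^ 2 := by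
  obtain ⟨δ, hδ⟩ := h.exists_taylor_eq_sq α
  set V := baseChange K (C (PowerSeries.C c) ^ 2 * unitFactor S * infFactor R₁ *
    zeroFactor d R₂ ^ 2) * G with hV
  have ht : baseChange K (tVar K) = C PowerSeries.X := by simp [baseChange, tVar]
  have hΔV : baseChange K Δ = C PowerSeries.X ^ (2 * p) * (taylor (-PowerSeries.C α) P * V) := by
    rw [hΔ, map_mul, hF, hV, ← ht]
    simp only [map_mul, map_pow]
    ring
  have htay : taylor (PowerSeries.C α) (baseChange K Δ) =
      C (PowerSeries.X ^ (2 * p)) * (P * taylor (PowerSeries.C α) V) := by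
    rw [hΔV, ← C_pow, taylor_mul, taylor_C, taylor_mul, taylor_taylor, add_neg_cancel, taylor_zero]
  rw [htay, Polynomial.coe_mul, Polynomial.coe_C, map_pow] at hδ
  obtain ⟨δ', hδ'⟩ := PowerSeries.exists_sq_of_C_X_pow_mul p hδ
  rw [Polynomial.coe_mul] at hδ'
  refine hP.exists_eq_sq ?_ hδ'
  -- The cofactor is a unit because at `t = 0`, `u = α` the polynomial `V` takes the value `c^2
  -- α^(2d) G(α)`, which is nonzero.
  rw [PowerSeries.isUnit_iff_constantCoeff, Polynomial.constantCoeff_coe,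
    PowerSeries.isUnit_iff_constantCoeff, ← coeff_map, map_taylor, taylor_coeff_zero,
    isUnit_iff_ne_zero, hV, Polynomial.map_mul, map_constantCoeff_baseChange]
  simp [hα, hG, hc]

end Main

end BrownSquare

theorem mainTheorem3 {K : Type*} [Field K] (Δ : Polynomial (PowerSeries K)) :
    (BrownSquare.HasSqrtInSeries Δ →
      ∃ (p d k : ℕ) (c : K) (S : PowerSeries K) (R₁ R₂ : Polynomial (PowerSeries K))
        (α : Fin k → AlgebraicClosure K) (e : Fin k → ℕ)
        (Q : Fin k → Polynomial (PowerSeries (AlgebraicClosure K))),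
        R₂.degree < (d : WithBot ℕ) ∧
        Function.Injective α ∧
        (∀ i, α i ≠ 0 ∧ 0 < e i ∧ (Q i).degree < (e i : WithBot ℕ)) ∧
        BrownSquare.baseChange K Δ =
          BrownSquare.baseChange K
            (Polynomial.C (PowerSeries.C c) ^ 2 * BrownSquare.tVar K ^ (2 * p) *
              BrownSquare.unitFactor S * BrownSquare.infFactor R₁ *
              BrownSquare.zeroFactor d R₂ ^ 2) *
          ∏ i, BrownSquare.finFactor (α i) (e i) (Q i)) ∧
    (BrownSquare.HasSqrtInPolySeries Δ →
      ∃ (p d k : ℕ) (c : K) (S : PowerSeries K) (R₁ R₂ : Polynomial (PowerSeries K))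
        (α : Fin k → AlgebraicClosure K) (e : Fin k → ℕ)
        (Q : Fin k → Polynomial (PowerSeries (AlgebraicClosure K))),
        R₂.degree < (d : WithBot ℕ) ∧
        Function.Injective α ∧
        (∀ i, α i ≠ 0 ∧ 0 < e i ∧ (Q i).degree < (e i : WithBot ℕ)) ∧
        BrownSquare.baseChange K Δ =
          BrownSquare.baseChange K
            (Polynomial.C (PowerSeries.C c) ^ 2 * BrownSquare.tVar K ^ (2 * p) *
              BrownSquare.unitFactor S * BrownSquare.infFactor R₁ *
              BrownSquare.zeroFactor d R₂ ^ 2) *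
          ∏ i, BrownSquare.finFactor (α i) (e i) (Q i) ^ 2) := by
  rcases eq_or_ne Δ 0 with rfl | h0
  -- For `Δ = 0` take `c = 0` and no `α`; `R₂ = 0` has degree `⊥ < 0 = d`.
  · constructor <;> intro _ <;>
    exact ⟨0, 0, 0, 0, 0, 0, 0, Fin.elim0, Fin.elim0, Fin.elim0, by simp,
      Function.injective_of_subsingleton _, fun i ↦ i.elim0, by simp⟩
  constructor
  · intro h
    obtain ⟨p, d, c, S, R₁, R₂, F, -, hR₂, hF0, hFdeg, hΔ⟩ :=
      BrownSquare.exists_eq_mul_of_hasSqrtInSeries h0 h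
    obtain ⟨k, α, e, Q, hα, hQ, hF⟩ := BrownSquare.exists_eq_prod_finFactor 1
      (BrownSquare.coeff_zero_baseChange hF0) (BrownSquare.natDegree_baseChange_le hFdeg)
      (fun α P G _ hP _ _ ↦ ⟨P, hP, (pow_one P).symm⟩)
    simp only [pow_one] at hF
    exact ⟨p, d, k, c, S, R₁, R₂, α, e, Q, hR₂, hα, hQ, by rw [← hF, ← map_mul, ← hΔ]⟩
  · intro h
    obtain ⟨p, d, c, S, R₁, R₂, F, hc, hR₂, hF0, hFdeg, hΔ⟩ :=
      BrownSquare.exists_eq_mul_of_hasSqrtInSeries h0 h.hasSqrtInSeries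
    obtain ⟨k, α, e, Q, hα, hQ, hF⟩ := BrownSquare.exists_eq_prod_finFactor 2
      (BrownSquare.coeff_zero_baseChange hF0) (BrownSquare.natDegree_baseChange_le hFdeg)
      (fun α P G hα hP hPG hG ↦
        BrownSquare.exists_eq_sq_of_hasSqrtInPolySeries h hc hΔ hα hP hPG hG)
    exact ⟨p, d, k, c, S, R₁, R₂, α, e, Q, hR₂, hα, hQ, by rw [← hF, ← map_mul, ← hΔ]⟩
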